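/- Let $\mathcal H$ and $\mathcal Y$ be Hilbert spaces over the same field, $\mathbb R$ or $\mathbb C$, let $A$ be the generator of a $C_0$-semigroup on $\mathcal H$, and let $C\in L(\mathcal H,\mathcal Y)$ be a bounded linear operator. An operator is called exponentially stable if it generates a $C_0$-semigroup $T(\cdot)$ on $\mathcal H$ with $T(\cdot)x\in L^2([0,\infty),\mathcal H)$ for each $x\in\mathcal H$, and the pair $(A,C)$ is called exponentially detectable if there exists $F\in L(\mathcal Y,\mathcal H)$ such that $A+FC$ (with domain $\operatorname{dom}A$) is exponentially stable. A self-adjoint $P\in L(\mathcal H)$ is called non-negative, written $P\ge 0$, if $\langle Px,x\rangle\ge 0$ for all $x\in\mathcal H$. For such $P$ consider the condition $$ \exists\,\eta,m>0\ \ \forall x\in\operatorname{dom}A:\qquad \|Cx\|^2-2\eta\,\mathrm{Re}\langle Ax,Px\rangle\ \ge\ m\|x\|^2. \qquad (\ast) $$ (1) If $(A,C)$ is exponentially detectable, then there exists a non-negative operator $P\in L(\mathcal H)$ such that $(\ast)$ holds. (2) Conversely, if $(\ast)$ holds for some non-negative $P\in L(\mathcal H)$ with $\operatorname{ran}C^*\subset\operatorname{ran}P$,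 then $(A,C)$ is exponentially detectable. -/

import Mathlib

open MeasureTheory Filter Topology

section

variable {𝕜 : Type*} [RCLike 𝕜] {H : Type*} [NormedAddCommGroup H] [InnerProductSpace 𝕜 H]
  {Y : Type*} [NormedAddCommGroup Y] [InnerProductSpace 𝕜 Y]

/-- A `C₀`-semigroup `(T t)` of bounded operators, `t ≥ 0`. The values of `T` at negative times
are irrelevant. -/
structure IsC0Semigroup (T : ℝ → H →L[𝕜] H) : Prop where
  map_zero : T 0 = ContinuousLinearMap.id 𝕜 H
  map_add : ∀ s t : ℝ, 0 ≤ s → 0 ≤ t → T (s + t) = (T s).comp (T t)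
  strongly_continuous : ∀ x : H, Tendsto (fun t : ℝ => T t x) (𝓝[>] 0) (𝓝 x)

/-- `A` is the infinitesimal generator of `T`: we have `x ∈ dom A` and `A x = y` exactly when
`(T t x - x) / t` tends to `y` as `t ↓ 0`. In particular, `dom A` consists of all `x` for which
this limit exists. -/
def IsInfinitesimalGenerator (A : H →ₗ.[𝕜] H) (T : ℝ → H →L[𝕜] H) : Prop :=
  ∀ x y : H, (x, y) ∈ A.graph ↔
    Tendsto (fun t : ℝ => ((t⁻¹ : ℝ) : 𝕜) • (T t x - x)) (𝓝[>] 0) (𝓝 y)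

/-- `A` generates a `C₀`-semigroup. -/
def GeneratesC0Semigroup (A : H →ₗ.[𝕜] H) : Prop :=
  ∃ T : ℝ → H →L[𝕜] H, IsC0Semigroup T ∧ IsInfinitesimalGenerator A T

/-- `A` is exponentially stable: it generates a `C₀`-semigroup `T` with
`T(·)x ∈ L²([0, ∞), H)` for every `x`. -/
def IsExponentiallyStable (A : H →ₗ.[𝕜] H) : Prop :=
  ∃ T : ℝ → H →L[𝕜] H, IsC0Semigroup T ∧ IsInfinitesimalGenerator A T ∧
    ∀ x : H, MemLp (fun t : ℝ => T t x) 2 (volume.restrict (Set.Ici (0 : ℝ)))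

/-- `(A, C)` is exponentially detectable: `A + F C`, with domain `dom A`, is exponentially stable
for some bounded `F`. -/
def IsExponentiallyDetectable (A : H →ₗ.[𝕜] H) (C : H →L[𝕜] Y) : Prop :=
  ∃ F : Y →L[𝕜] H, IsExponentiallyStable (((F.comp C : H →L[𝕜] H) : H →ₗ[𝕜] H) +ᵥ A)

/-- The Lyapunov-like form inequality: for some `η, m > 0`,
`‖C x‖² - 2 η Re ⟨A x, P x⟩ ≥ m ‖x‖²` for all `x ∈ dom A`. -/
def LyapunovFormInequality (A : H →ₗ.[𝕜] H) (C : H →L[𝕜] Y) (P : H →L[𝕜] H) : Prop :=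
  ∃ η m : ℝ, 0 < η ∧ 0 < m ∧ ∀ x : A.domain,
    m * ‖(x : H)‖ ^ 2 ≤ ‖C (x : H)‖ ^ 2 - 2 * η * RCLike.re (inner 𝕜 (A x) (P (x : H)))

end

/-! The form `Re ⟨x, P x⟩` serves as a Lyapunov function for `A + F C`.

For (2), `ran C* ⊆ ran P` gives a bounded `G` with `C* = P G`. Taking `F = -(1/(2η)) G` yields `Re
⟨F C x, P x⟩ = -‖C x‖²/(2η)`, so the form inequality becomes `2 Re ⟨(A + F C) x, P x⟩ ≤ -(m/η)
‖x‖²`. As a bounded perturbation of a generator, `A + F C` generates a semigroup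
(`GeneratesC0Semigroup.vadd`), and integrating along its orbits bounds their L² norms
(`memLp_orbit`).

For (1), `⟨P x, x⟩ = ∫ ‖T t x‖² dt` defines a bounded `P` with `2 Re ⟨(A + F C) x, P x⟩ = -‖x‖²`
(`exists_lyapunov`). The cross term from `F C` is absorbed into `‖C x‖²` by Young's inequality,
provided `η` is small. -/

section Semigroup

variable {𝕜 : Type*} [RCLike 𝕜] {H : Type*} [NormedAddCommGroup H] [InnerProductSpace 𝕜 H]
  {T : ℝ → H →L[𝕜] H}

/-! ### Growth bounds and continuity of `C₀`-semigroups. -/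

namespace IsC0Semigroup

theorem tendsto_nhdsGE (hT : IsC0Semigroup T) (x : H) :
    Tendsto (fun t : ℝ => T t x) (𝓝[≥] 0) (𝓝 x) := by
  have h : ContinuousWithinAt (fun t : ℝ => T t x) (Set.Ioi 0) 0 := by
    simpa [ContinuousWithinAt, hT.map_zero] using hT.strongly_continuous x
  simpa [ContinuousWithinAt, hT.map_zero] using continuousWithinAt_Ioi_iff_Ici.mp h

/-- Otherwise `‖T (t n)‖` is unbounded along some `t n → 0`, although each `T (t n) x` converges;
this contradicts uniform boundedness. -/
theorem exists_norm_le_near_zero [CompleteSpace H] (hT : IsC0Semigroup T) :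
    ∃ δ : ℝ, 0 < δ ∧ ∃ M : ℝ, 1 ≤ M ∧ ∀ t, 0 ≤ t → t ≤ δ → ‖T t‖ ≤ M := by
  by_contra! hcon
  have hpos : ∀ n : ℕ, (0 : ℝ) < 1 / ((n : ℝ) + 1) := fun n => Nat.one_div_pos_of_nat
  choose t ht0 htn hbig using fun n : ℕ => hcon _ (hpos n) ((n : ℝ) + 1) (by simp)
  have htlim : Tendsto t atTop (𝓝[≥] 0) := by
    refine tendsto_nhdsWithin_iff.mpr ⟨?_, Eventually.of_forall ht0⟩
    exact squeeze_zero ht0 htn tendsto_one_div_add_atTop_nhds_zero_nat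
  obtain ⟨K, hK⟩ := banach_steinhaus (g := fun n => T (t n)) fun x => by
    obtain ⟨K, hK⟩ := ((hT.tendsto_nhdsGE x).comp htlim).norm.bddAbove_range
    exact ⟨K, fun n => hK ⟨n, rfl⟩⟩
  obtain ⟨n, hn⟩ := exists_nat_gt K
  linarith [hK n, hbig n]

/-- A `C₀`-semigroup is exponentially bounded. -/
theorem exists_norm_le_exp [CompleteSpace H] (hT : IsC0Semigroup T) :
    ∃ M ω : ℝ, 1 ≤ M ∧ 0 ≤ ω ∧ ∀ t, 0 ≤ t → ‖T t‖ ≤ M * Real.exp (ω * t) := by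
  obtain ⟨δ, hδ, M, hM, hb⟩ := hT.exists_norm_le_near_zero
  have hM0 : 0 < M := by linarith
  have hpow : ∀ n : ℕ, ∀ t, 0 ≤ t → t ≤ (n + 1) * δ → ‖T t‖ ≤ M ^ (n + 1) := by
    intro n
    induction n with
    | zero => intro t h0 h1; simpa using hb t h0 (by simpa using h1)
    | succ n ih =>
      intro t h0 h1
      by_cases htδ : t ≤ δ
      · exact (hb t h0 htδ).trans (le_self_pow₀ hM (by simp))
      · push Not at htδ
        have h2 : t - δ ≤ (n + 1) * δ := by push_cast at h1; linarith
        have h3 : T t = (T δ).comp (T (t - δ)) := by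
          rw [← hT.map_add _ _ hδ.le (by linarith)]; simp
        rw [h3, pow_succ']
        exact (ContinuousLinearMap.opNorm_comp_le _ _).trans
          (mul_le_mul (hb δ hδ.le le_rfl) (ih _ (by linarith) h2) (norm_nonneg _) hM0.le)
  -- The rate makes `exp (ω δ) = M`: each full step of length `δ` costs a factor `M`, and the last
  -- partial step gives the prefactor.
  refine ⟨M, Real.log M / δ, hM, div_nonneg (Real.log_nonneg hM) hδ.le, fun t ht => ?_⟩
  have hfl := Nat.floor_le (div_nonneg ht hδ.le)
  have hfl2 := Nat.lt_floor_add_one (t / δ)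
  refine (hpow ⌊t / δ⌋₊ t ht ((div_lt_iff₀ hδ).mp hfl2).le).trans ?_
  rw [pow_succ']
  gcongr
  calc M ^ ⌊t / δ⌋₊ = Real.exp (Real.log M * ⌊t / δ⌋₊) := by
        rw [Real.exp_mul, Real.exp_log hM0, Real.rpow_natCast]
    _ ≤ Real.exp (Real.log M * (t / δ)) := by
        gcongr; exact Real.log_nonneg hM
    _ = _ := by congr 1; ring

theorem norm_sub_le (hT : IsC0Semigroup T) {M ω : ℝ} (hM : 0 ≤ M) (hω : 0 ≤ ω)
    (hb : ∀ t, 0 ≤ t → ‖T t‖ ≤ M * Real.exp (ω * t)) {s t : ℝ} (hs : 0 ≤ s) (ht : 0 ≤ t) (x : H) :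
    ‖T s x - T t x‖ ≤ M * Real.exp (ω * max s t) * ‖T |s - t| x - x‖ := by
  wlog hst : t ≤ s generalizing s t
  · rw [norm_sub_rev, max_comm, abs_sub_comm]
    exact this ht hs (by linarith)
  have h1 : T s x = T t (T (s - t) x) := by
    rw [← ContinuousLinearMap.comp_apply, ← hT.map_add _ _ ht (by linarith)]; simp
  rw [abs_of_nonneg (by linarith), h1, ← map_sub]
  refine (ContinuousLinearMap.le_opNorm _ _).trans ?_
  gcongr
  refine (hb t ht).trans ?_
  gcongr
  exact le_max_right _ _

/-- A `C₀`-semigroup, extended to negative times by the identity, is jointly continuous. -/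
theorem continuous_uncurry [CompleteSpace H] (hT : IsC0Semigroup T) :
    Continuous fun p : ℝ × H => T (max p.1 0) p.2 := by
  obtain ⟨M, ω, hM, hω, hb⟩ := hT.exists_norm_le_exp
  have hM0 : 0 ≤ M := by linarith
  rw [continuous_iff_continuousAt]
  rintro ⟨t, x⟩
  rw [ContinuousAt, tendsto_iff_norm_sub_tendsto_zero]
  have hlim : Tendsto (fun p : ℝ × H => T |max p.1 0 - max t 0| x) (𝓝 (t, x)) (𝓝 x) := by
    refine (hT.tendsto_nhdsGE x).comp (tendsto_nhdsWithin_iff.mpr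
      ⟨?_, Eventually.of_forall fun _ => Set.mem_Ici.mpr (abs_nonneg _)⟩)
    have : Continuous fun p : ℝ × H => |max p.1 0 - max t 0| := by fun_prop
    simpa using this.tendsto (t, x)
  have hexp : Continuous fun p : ℝ × H => M * Real.exp (ω * max (max p.1 0) (max t 0)) := by
    fun_prop
  have hlim2 : Tendsto (fun p : ℝ × H => M * Real.exp (ω * max (max p.1 0) (max t 0)) *
      (‖p.2 - x‖ + ‖T |max p.1 0 - max t 0| x - x‖)) (𝓝 (t, x)) (𝓝 0) := by
    have h1 : Tendsto (fun p : ℝ × H => ‖p.2 - x‖) (𝓝 (t, x)) (𝓝 0) := by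
      have : Continuous fun p : ℝ × H => ‖p.2 - x‖ := by fun_prop
      simpa using this.tendsto (t, x)
    have h2 := h1.add (tendsto_iff_norm_sub_tendsto_zero.mp hlim)
    simpa using (hexp.tendsto (t, x)).mul h2
  refine squeeze_zero (fun _ => norm_nonneg _) (fun p => ?_) hlim2
  have hsplit : T (max p.1 0) p.2 - T (max t 0) x =
      T (max p.1 0) (p.2 - x) + (T (max p.1 0) x - T (max t 0) x) := by
    rw [map_sub]; abel
  rw [hsplit, mul_add]
  refine (norm_add_le _ _).trans (add_le_add ?_
    (hT.norm_sub_le hM0 hω hb (le_max_right _ _) (le_max_right _ _) x))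
  refine (ContinuousLinearMap.le_opNorm _ _).trans ?_
  gcongr
  refine (hb _ (le_max_right _ _)).trans ?_
  gcongr M * Real.exp (ω * ?_)
  exact le_max_left _ _

theorem continuous_orbit [CompleteSpace H] (hT : IsC0Semigroup T) (x : H) :
    Continuous fun t : ℝ => T (max t 0) x :=
  hT.continuous_uncurry.comp (by fun_prop : Continuous fun t : ℝ => (t, x))

theorem continuousOn_orbit [CompleteSpace H] (hT : IsC0Semigroup T) (x : H) :
    ContinuousOn (fun t : ℝ => T t x) (Set.Ici 0) :=
  (hT.continuous_orbit x).continuousOn.congr fun t ht => by simp [max_eq_left (Set.mem_Ici.mp ht)]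

/-- Clamping `t - s` at `0` makes the integrand continuous on the whole plane without changing it
for `s ≤ t`. -/
theorem continuous_convolution_integrand [CompleteSpace H] (hT : IsC0Semigroup T) (B : H →L[𝕜] H)
    {u : ℝ → H} (hu : Continuous u) :
    Continuous fun p : ℝ × ℝ => T (max (p.1 - p.2) 0) (B (u p.2)) :=
  hT.continuous_uncurry.comp
    (by fun_prop : Continuous fun p : ℝ × ℝ => (p.1 - p.2, B (u p.2)))

/-- Rescaling turns an exponential bound into decay, so the perturbation equation can be solved on
the whole half-line at once. -/
theorem exp_smul (hT : IsC0Semigroup T) (μ : ℝ) :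
    IsC0Semigroup fun t => ((Real.exp (μ * t) : ℝ) : 𝕜) • T t where
  map_zero := by simp [hT.map_zero]
  map_add s t hs ht := by
    ext x
    simp [hT.map_add s t hs ht, mul_add, Real.exp_add, smul_smul, mul_comm]
  strongly_continuous x := by
    have h1 : Tendsto (fun t : ℝ => ((Real.exp (μ * t) : ℝ) : 𝕜)) (𝓝[>] 0) (𝓝 1) := by
      have : Continuous fun t : ℝ => ((Real.exp (μ * t) : ℝ) : 𝕜) := by fun_prop
      simpa using (this.tendsto 0).mono_left nhdsWithin_le_nhds
    simpa using h1.smul (hT.strongly_continuous x)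

end IsC0Semigroup

/-! ### The generator: differentiable orbits and dense domain. -/

section Generator

variable [NormedSpace ℝ H] [IsScalarTower ℝ 𝕜 H] {A : H →ₗ.[𝕜] H}

theorem IsInfinitesimalGenerator.mem_graph_iff_hasDerivWithinAt (hA : IsInfinitesimalGenerator A T)
    (hT : IsC0Semigroup T) (x y : H) :
    (x, y) ∈ A.graph ↔ HasDerivWithinAt (fun t : ℝ => T t x) y (Set.Ici 0) 0 := by
  rw [hA x y, ← hasDerivWithinAt_Ioi_iff_Ici, hasDerivWithinAt_iff_tendsto_slope' (by simp)]
  refine tendsto_congr fun t => ?_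
  simp [slope, hT.map_zero, RCLike.real_smul_eq_coe_smul (K := 𝕜)]

/-- Orbits starting in the domain of the generator stay there and are differentiable from the
right. -/
theorem IsInfinitesimalGenerator.orbit (hA : IsInfinitesimalGenerator A T)
    (hT : IsC0Semigroup T) {x y : H} (hxy : (x, y) ∈ A.graph) {t : ℝ} (ht : 0 ≤ t) :
    (T t x, T t y) ∈ A.graph ∧
      HasDerivWithinAt (fun s : ℝ => T s x) (T t y) (Set.Ici t) t := by
  have h0 := (hA.mem_graph_iff_hasDerivWithinAt hT x y).mp hxy
  have h1 : HasDerivWithinAt (fun s : ℝ => T t (T s x)) (T t y) (Set.Ici 0) 0 :=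
    ((T t).restrictScalars ℝ).hasFDerivAt.comp_hasDerivWithinAt (0 : ℝ) h0
  constructor
  · rw [hA.mem_graph_iff_hasDerivWithinAt hT]
    refine h1.congr_of_mem (fun s hs => ?_) Set.self_mem_Ici
    have hs : (0 : ℝ) ≤ s := hs
    rw [← ContinuousLinearMap.comp_apply, ← ContinuousLinearMap.comp_apply,
      ← hT.map_add _ _ hs ht, ← hT.map_add _ _ ht hs, add_comm]
  · have h2 : HasDerivWithinAt (fun s : ℝ => T t (T (s - t) x)) (T t y) (Set.Ici t) t := by
      have h3 : HasDerivWithinAt (fun s : ℝ => s - t) 1 (Set.Ici t) t :=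
        (hasDerivWithinAt_id t _).sub_const t
      have h4 : HasDerivWithinAt (fun s : ℝ => T t (T s x)) (T t y) (Set.Ici 0) (t - t) := by
        simpa using h1
      simpa [Function.comp_def] using
        HasDerivWithinAt.scomp (h := fun s : ℝ => s - t) t h4 h3
          (fun s hs => sub_nonneg.mpr (Set.mem_Ici.mp hs))
    refine h2.congr_of_mem (fun s hs => ?_) Set.self_mem_Ici
    have hs : t ≤ s := hs
    rw [← ContinuousLinearMap.comp_apply, ← hT.map_add _ _ ht (by linarith)]
    simp

/-- `T h` shifts the interval of integration to `[h, t + h]`, so the claim is the fundamental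
theorem of calculus at both ends. -/
theorem IsInfinitesimalGenerator.integral_mem_domain [CompleteSpace H]
    (hA : IsInfinitesimalGenerator A T) (hT : IsC0Semigroup T) (x : H) {t : ℝ} (ht : 0 ≤ t) :
    (∫ s in (0 : ℝ)..t, T (max s 0) x, T t x - x) ∈ A.graph := by
  have hc := hT.continuous_orbit x
  have hi : ∀ a b : ℝ, IntervalIntegrable (fun s : ℝ => T (max s 0) x) volume a b :=
    fun a b => hc.intervalIntegrable a b
  rw [hA.mem_graph_iff_hasDerivWithinAt hT]
  have key : ∀ h : ℝ, 0 ≤ h → T h (∫ s in (0 : ℝ)..t, T (max s 0) x) =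
      (∫ s in (0 : ℝ)..(t + h), T (max s 0) x) - ∫ s in (0 : ℝ)..h, T (max s 0) x := by
    intro h hh
    rw [intervalIntegral.integral_interval_sub_left (hi _ _) (hi _ _),
      show T h (∫ s in (0 : ℝ)..t, T (max s 0) x) =
        (T h).restrictScalars ℝ (∫ s in (0 : ℝ)..t, T (max s 0) x) from rfl,
      ← ContinuousLinearMap.intervalIntegral_comp_comm _ (hi _ _)]
    have := intervalIntegral.integral_comp_add_right (a := 0) (b := t)
      (fun s : ℝ => T (max s 0) x) h
    rw [zero_add] at this
    rw [← this]
    refine intervalIntegral.integral_congr fun s hs => ?_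
    rw [Set.uIcc_of_le ht] at hs
    simp only [ContinuousLinearMap.coe_restrictScalars']
    rw [max_eq_left hs.1, max_eq_left (by linarith [hs.1]), add_comm, hT.map_add _ _ hh hs.1]
    rfl
  have hd : ∀ a : ℝ, HasDerivAt (fun b : ℝ => ∫ s in (0 : ℝ)..b, T (max s 0) x)
      (T (max a 0) x) a := fun a => hc.integral_hasStrictDerivAt 0 a |>.hasDerivAt
  have h1 : HasDerivAt (fun h : ℝ => (∫ s in (0 : ℝ)..(t + h), T (max s 0) x) -
      ∫ s in (0 : ℝ)..h, T (max s 0) x) (T t x - x) 0 := by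
    have h2 := (hd (t + 0)).comp_const_add t 0
    have h3 := h2.sub (hd 0)
    simpa [max_eq_left ht, hT.map_zero, Pi.sub_def] using h3
  exact h1.hasDerivWithinAt.congr_of_mem (fun h hh => key h hh) Set.self_mem_Ici

/-- The generator of a `C₀`-semigroup is densely defined. -/
theorem IsInfinitesimalGenerator.dense_domain [CompleteSpace H]
    (hA : IsInfinitesimalGenerator A T) (hT : IsC0Semigroup T) : Dense (A.domain : Set H) := by
  intro x
  -- The averages of the orbit over `[0, t]` lie in the domain and tend to `x` as `t ↓ 0`.
  have hd : HasDerivAt (fun b : ℝ => ∫ s in (0 : ℝ)..b, T (max s 0) x) x 0 := by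
    simpa [hT.map_zero] using
      ((hT.continuous_orbit x).integral_hasStrictDerivAt 0 0).hasDerivAt
  have hs := (hasDerivWithinAt_iff_tendsto_slope' (by simp)).mp
    (hd.hasDerivWithinAt (s := Set.Ioi (0 : ℝ)))
  refine mem_closure_of_tendsto hs (eventually_mem_nhdsWithin.mono fun t ht => ?_)
  have ht : (0 : ℝ) < t := ht
  have : slope (fun b : ℝ => ∫ s in (0 : ℝ)..b, T (max s 0) x) 0 t =
      ((t⁻¹ : ℝ) : 𝕜) • ∫ s in (0 : ℝ)..t, T (max s 0) x := by
    simp [slope, RCLike.real_smul_eq_coe_smul (K := 𝕜)]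
  rw [this]
  exact A.domain.smul_mem _ (LinearPMap.mem_domain_of_mem_graph
    (hA.integral_mem_domain hT x ht.le))

end Generator

end Semigroup

/-! ### Bounded perturbations of generators. -/

section Perturbation

open scoped BoundedContinuousFunction

variable {𝕜 : Type*} [RCLike 𝕜] {H : Type*} [NormedAddCommGroup H] [InnerProductSpace 𝕜 H]
  [CompleteSpace H] [NormedSpace ℝ H] [IsScalarTower ℝ 𝕜 H] {T : ℝ → H →L[𝕜] H}

theorem integral_exp_neg_mul_sub_le {ν : ℝ} (hν : 0 < ν) (t : ℝ) :
    ∫ s in (0 : ℝ)..t, Real.exp (-ν * (t - s)) ≤ 1 / ν := by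
  have hderiv : ∀ s ∈ Set.uIcc 0 t,
      HasDerivAt (fun s : ℝ => Real.exp (-ν * (t - s)) / ν) (Real.exp (-ν * (t - s))) s := by
    intro s _
    have h1 : HasDerivAt (fun s : ℝ => -ν * (t - s)) ν s := by
      simpa using ((hasDerivAt_id s).const_sub t).const_mul (-ν)
    have h2 := h1.exp.div_const ν
    rwa [mul_div_cancel_right₀ _ hν.ne'] at h2
  rw [intervalIntegral.integral_eq_sub_of_hasDerivAt hderiv
    (Continuous.intervalIntegrable (by fun_prop) _ _)]
  have : 0 ≤ Real.exp (-ν * (t - 0)) / ν := by positivity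
  simp only [sub_self, mul_zero, Real.exp_zero]
  linarith

/-- The Volterra operator `u ↦ ∫₀ᵗ T (t - s) B u(s) ds` of an exponentially decaying semigroup, on
bounded continuous functions. -/
theorem IsC0Semigroup.exists_volterra (hT : IsC0Semigroup T) {M ν : ℝ} (hM : 0 ≤ M) (hν : 0 < ν)
    (hb : ∀ t, 0 ≤ t → ‖T t‖ ≤ M * Real.exp (-ν * t)) (B : H →L[𝕜] H) :
    ∃ Φ : (ℝ →ᵇ H) →L[𝕜] (ℝ →ᵇ H), ‖Φ‖ ≤ M * ‖B‖ / ν ∧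
      ∀ u t, Φ u t = ∫ s in (0 : ℝ)..max t 0, T (max (max t 0 - s) 0) (B (u s)) := by
  have hcont : ∀ u : ℝ →ᵇ H, Continuous fun t : ℝ =>
      ∫ s in (0 : ℝ)..max t 0, T (max (max t 0 - s) 0) (B (u s)) := fun u =>
    intervalIntegral.continuous_parametric_intervalIntegral_of_continuous
      (f := fun t s : ℝ => T (max (max t 0 - s) 0) (B (u s)))
      ((hT.continuous_convolution_integrand B u.continuous).comp
        (by fun_prop : Continuous fun p : ℝ × ℝ => (max p.1 0, p.2))) (by fun_prop)
  have hint : ∀ (u : ℝ →ᵇ H) (t a b : ℝ),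
      IntervalIntegrable (fun s : ℝ => T (max (t - s) 0) (B (u s))) volume a b := fun u t a b =>
    ((hT.continuous_convolution_integrand B u.continuous).comp
        (by fun_prop : Continuous fun s : ℝ => (t, s))).intervalIntegrable a b
  have hbound : ∀ (u : ℝ →ᵇ H) (t : ℝ),
      ‖∫ s in (0 : ℝ)..max t 0, T (max (max t 0 - s) 0) (B (u s))‖ ≤ M * ‖B‖ / ν * ‖u‖ := by
    intro u t
    have ht : 0 ≤ max t 0 := le_max_right _ _
    generalize max t 0 = r at ht
    calc ‖∫ s in (0 : ℝ)..r, T (max (r - s) 0) (B (u s))‖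
        ≤ ∫ s in (0 : ℝ)..r, M * ‖B‖ * ‖u‖ * Real.exp (-ν * (r - s)) := by
          refine intervalIntegral.norm_integral_le_of_norm_le ht
            (Eventually.of_forall fun s hs => ?_) (Continuous.intervalIntegrable (by fun_prop) _ _)
          rw [max_eq_left (by linarith [hs.2])]
          calc ‖T (r - s) (B (u s))‖ ≤ ‖T (r - s)‖ * (‖B‖ * ‖u‖) :=
                (ContinuousLinearMap.le_opNorm _ _).trans (by
                  gcongr
                  exact (ContinuousLinearMap.le_opNorm _ _).trans (by
                    gcongr; exact u.norm_coe_le_norm s))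
            _ ≤ (M * Real.exp (-ν * (r - s))) * (‖B‖ * ‖u‖) := by
                gcongr; exact hb _ (by linarith [hs.2])
            _ = _ := by ring
      _ ≤ M * ‖B‖ * ‖u‖ * (1 / ν) := by
          rw [intervalIntegral.integral_const_mul]
          gcongr
          exact integral_exp_neg_mul_sub_le hν r
      _ = _ := by ring
  let V (u : ℝ →ᵇ H) : ℝ →ᵇ H := BoundedContinuousFunction.ofNormedAddCommGroup _ (hcont u) _
    (hbound u)
  have hV : ∀ u t, V u t = ∫ s in (0 : ℝ)..max t 0, T (max (max t 0 - s) 0) (B (u s)) :=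
    fun _ _ => rfl
  let L : (ℝ →ᵇ H) →ₗ[𝕜] (ℝ →ᵇ H) :=
    { toFun := V
      map_add' := fun u v => by
        ext t
        rw [BoundedContinuousFunction.add_apply, hV, hV, hV,
          ← intervalIntegral.integral_add (hint _ _ _ _) (hint _ _ _ _)]
        simp
      map_smul' := fun c u => by
        ext t
        rw [RingHom.id_apply, BoundedContinuousFunction.smul_apply, hV, hV,
          ← intervalIntegral.integral_smul]
        simp }
  have hL : ∀ u, ‖L u‖ ≤ M * ‖B‖ / ν * ‖u‖ := fun u =>
    (BoundedContinuousFunction.norm_le (by positivity)).mpr (hbound u)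
  exact ⟨L.mkContinuous _ hL, L.mkContinuous_norm_le (by positivity) hL, fun u t => hV u t⟩

/-- Variation of constants for an exponentially decaying semigroup and a small perturbation. -/
theorem IsC0Semigroup.exists_perturbation_of_decay (hT : IsC0Semigroup T) {M ν : ℝ} (hM : 0 ≤ M)
    (hν : 0 < ν) (hb : ∀ t, 0 ≤ t → ‖T t‖ ≤ M * Real.exp (-ν * t)) (B : H →L[𝕜] H)
    (hB : M * ‖B‖ < ν) :
    ∃ S : ℝ → H →L[𝕜] H, IsC0Semigroup S ∧ ∀ t, 0 ≤ t → ∀ x,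
      S t x = T t x + ∫ s in (0 : ℝ)..t, T (max (t - s) 0) (B (S (max s 0) x)) := by
  obtain ⟨Φ, hΦn, hΦ⟩ := hT.exists_volterra hM hν hb B
  have hΦ1 : ‖Φ‖ < 1 := hΦn.trans_lt ((div_lt_one hν).mpr hB)
  have hTle : ∀ x t, ‖T (max t 0) x‖ ≤ M * ‖x‖ := fun x t => by
    refine (ContinuousLinearMap.le_opNorm _ _).trans ?_
    gcongr
    refine (hb _ (le_max_right _ _)).trans (mul_le_of_le_one_right hM ?_)
    rw [Real.exp_le_one_iff]
    nlinarith [le_max_right t 0]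
  let J : H →L[𝕜] (ℝ →ᵇ H) := LinearMap.mkContinuous
    { toFun := fun x => BoundedContinuousFunction.ofNormedAddCommGroup (fun t : ℝ => T (max t 0) x)
        (hT.continuous_orbit x) _ (hTle x)
      map_add' := fun x y => by ext t; simp
      map_smul' := fun c x => by ext t; simp } M
    (fun x => (BoundedContinuousFunction.norm_le (by positivity)).mpr (hTle x))
  have hJ : ∀ x t, J x t = T (max t 0) x := fun _ _ => rfl
  -- The orbit of `x` must solve `u = J x + Φ u`; since `‖Φ‖ < 1`, the operator `1 - Φ` is
  -- invertible, which gives existence and uniqueness.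
  let U := Units.oneSub Φ hΦ1
  let N : (ℝ →ᵇ H) →L[𝕜] (ℝ →ᵇ H) := (U⁻¹ : ((ℝ →ᵇ H) →L[𝕜] (ℝ →ᵇ H))ˣ)
  have hUN : ∀ u, N u = u + Φ (N u) := fun u => by
    have h : ((U : (ℝ →ᵇ H) →L[𝕜] (ℝ →ᵇ H)) * N) u = u := by simp [N]
    have h2 : N u - Φ (N u) = u := h
    exact sub_eq_iff_eq_add.mp h2
  have huniq : ∀ u v, v = u + Φ v → v = N u := fun u v h => by
    have h1 : (N * (U : (ℝ →ᵇ H) →L[𝕜] (ℝ →ᵇ H))) v = v := by simp [N]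
    have h2 : N (v - Φ v) = v := h1
    rw [← h2]
    congr 1
    rw [sub_eq_iff_eq_add]; exact h
  let S : ℝ → H →L[𝕜] H := fun t => (BoundedContinuousFunction.evalCLM 𝕜 t).comp (N.comp J)
  have hSN : ∀ t x, S t x = N (J x) t := fun _ _ => rfl
  have hScont : ∀ x, Continuous fun t => S t x := fun x => (N (J x)).continuous
  have hSeq : ∀ t x, S t x = T (max t 0) x +
      ∫ s in (0 : ℝ)..max t 0, T (max (max t 0 - s) 0) (B (S s x)) := fun t x => by
    conv_lhs => rw [hSN, hUN, BoundedContinuousFunction.add_apply, hJ, hΦ]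
    rfl
  have hS0 : S 0 = ContinuousLinearMap.id 𝕜 H := by
    ext x
    rw [hSeq]; simp [hT.map_zero]
  have hi : ∀ x t a b, IntervalIntegrable (fun s : ℝ => T (max (t - s) 0) (B (S s x))) volume a b :=
    fun x t a b => ((hT.continuous_convolution_integrand B (hScont x)).comp
        (by fun_prop : Continuous fun s : ℝ => (t, s))).intervalIntegrable a b
  have hSadd : ∀ t r, 0 ≤ t → 0 ≤ r → ∀ x, S (t + r) x = S t (S r x) := by
    intro t r ht hr x
    let v : ℝ →ᵇ H := BoundedContinuousFunction.ofNormedAddCommGroup (fun t : ℝ => S (max t 0 + r) x)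
      ((hScont x).comp (by fun_prop)) ‖N (J x)‖ fun t => (N (J x)).norm_coe_le_norm _
    -- The shifted orbit solves the equation with initial value `S r x`, as splitting the integral
    -- at `r` shows. Uniqueness then gives the semigroup law.
    have hv : v = J (S r x) + Φ v := by
      ext t
      rw [BoundedContinuousFunction.add_apply, hJ, hΦ]
      change S (max t 0 + r) x = _ + ∫ s in (0 : ℝ)..max t 0,
        T (max (max t 0 - s) 0) (B (S (max s 0 + r) x))
      have ht : 0 ≤ max t 0 := le_max_right _ _
      generalize max t 0 = t at ht
      rw [hSeq (t + r), hSeq r, max_eq_left (by positivity : 0 ≤ t + r), max_eq_left hr, _root_.map_add,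
        hT.map_add _ _ ht hr, ContinuousLinearMap.comp_apply, add_assoc]
      congr 1
      rw [← intervalIntegral.integral_add_adjacent_intervals (hi _ _ 0 r) (hi _ _ r (t + r))]
      congr 1
      · rw [show T t (∫ s in (0 : ℝ)..r, T (max (r - s) 0) (B (S s x))) =
          (T t).restrictScalars ℝ (∫ s in (0 : ℝ)..r, T (max (r - s) 0) (B (S s x))) from rfl,
          ← ContinuousLinearMap.intervalIntegral_comp_comm _ (hi _ _ _ _)]
        refine intervalIntegral.integral_congr fun s hs => ?_
        rw [Set.uIcc_of_le hr] at hs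
        have hs2 : 0 ≤ r - s := by linarith [hs.2]
        simp only [ContinuousLinearMap.coe_restrictScalars']
        rw [max_eq_left hs2, max_eq_left (by linarith), add_sub_assoc, hT.map_add _ _ ht hs2]
        rfl
      · have := intervalIntegral.integral_comp_add_right (a := 0) (b := t)
          (fun s : ℝ => T (max (t + r - s) 0) (B (S s x))) r
        rw [zero_add] at this
        rw [← this]
        refine intervalIntegral.integral_congr fun s hs => ?_
        rw [Set.uIcc_of_le ht] at hs
        rw [max_eq_left hs.1, add_sub_add_right_eq_sub]
    have h1 : v t = N (J (S r x)) t := by rw [← huniq _ _ hv]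
    rw [hSN t (S r x), ← h1]
    change _ = S (max t 0 + r) x
    rw [max_eq_left ht]
  refine ⟨S, ⟨hS0, fun s t hs ht => ?_, fun x => ?_⟩, fun t ht x => ?_⟩
  · ext x; exact hSadd s t hs ht x
  · have := (hScont x).tendsto 0
    rw [hS0] at this
    exact this.mono_left nhdsWithin_le_nhds
  · rw [hSeq, max_eq_left ht]
    congr 1
    refine intervalIntegral.integral_congr fun s hs => ?_
    rw [Set.uIcc_of_le ht] at hs
    rw [max_eq_left hs.1]

/-- Variation of constants for bounded perturbations of `C₀`-semigroups. -/
theorem IsC0Semigroup.exists_perturbation (hT : IsC0Semigroup T) (B : H →L[𝕜] H) :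
    ∃ S : ℝ → H →L[𝕜] H, IsC0Semigroup S ∧ ∀ t, 0 ≤ t → ∀ x,
      S t x = T t x + ∫ s in (0 : ℝ)..t, T (max (t - s) 0) (B (S (max s 0) x)) := by
  obtain ⟨M, ω, hM, hω, hb⟩ := hT.exists_norm_le_exp
  have hM0 : 0 ≤ M := by linarith
  -- Any `ν > M ‖B‖` makes the rescaled problem a contraction; the weight `exp (-(ω + ν) t)` is
  -- undone at the end.
  set ν : ℝ := M * ‖B‖ + 1 with hνdef
  have hν : 0 < ν := by positivity
  obtain ⟨S, hS, hSeq⟩ := (hT.exp_smul (-(ω + ν))).exists_perturbation_of_decay hM0 hν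
    (fun t ht => by
      rw [norm_smul, RCLike.norm_ofReal, abs_of_pos (Real.exp_pos _)]
      calc Real.exp (-(ω + ν) * t) * ‖T t‖
          ≤ Real.exp (-(ω + ν) * t) * (M * Real.exp (ω * t)) := by gcongr; exact hb t ht
        _ = M * (Real.exp (-(ω + ν) * t) * Real.exp (ω * t)) := by ring
        _ = _ := by rw [← Real.exp_add]; congr 2; ring) B (by linarith)
  refine ⟨_, hS.exp_smul (ω + ν), fun t ht x => ?_⟩
  simp only [_root_.smul_apply]
  rw [hSeq t ht x, smul_add, _root_.smul_apply, smul_smul, ← RCLike.ofReal_mul,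
    ← Real.exp_add]
  congr 1
  · rw [show (ω + ν) * t + -(ω + ν) * t = 0 by ring]; simp
  · rw [← intervalIntegral.integral_smul]
    refine intervalIntegral.integral_congr fun s hs => ?_
    rw [Set.uIcc_of_le ht] at hs
    simp only [_root_.smul_apply, map_smul]
    rw [smul_smul, ← RCLike.ofReal_mul, ← Real.exp_add, max_eq_left (by linarith [hs.2]),
      max_eq_left hs.1]
    congr 3
    ring_nf

/-- Bounded perturbations of generators of `C₀`-semigroups are generators. -/
theorem GeneratesC0Semigroup.vadd {A : H →ₗ.[𝕜] H} (hA : GeneratesC0Semigroup A) (B : H →L[𝕜] H) :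
    GeneratesC0Semigroup ((B : H →ₗ[𝕜] H) +ᵥ A) := by
  obtain ⟨T, hT, hAT⟩ := hA
  obtain ⟨S, hS, hSeq⟩ := hT.exists_perturbation B
  refine ⟨S, hS, fun x y => ?_⟩
  have hgraph : (x, y) ∈ ((B : H →ₗ[𝕜] H) +ᵥ A).graph ↔ (x, y - B x) ∈ A.graph := by
    simp only [LinearPMap.mem_graph_iff]
    constructor
    · rintro ⟨z, rfl, rfl⟩
      exact ⟨z, rfl, by simp [LinearPMap.vadd_apply]⟩
    · rintro ⟨z, rfl, hz⟩
      exact ⟨z, rfl, by simp [LinearPMap.vadd_apply, hz]⟩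
  -- The difference quotients of `S` and `T` differ by this term, so they converge simultaneously
  -- and the domains agree. Rescaling to `[0, 1]` makes the limit a continuity statement.
  have hconv : Tendsto (fun t : ℝ => ((t⁻¹ : ℝ) : 𝕜) •
      ∫ s in (0 : ℝ)..t, T (max (t - s) 0) (B (S (max s 0) x))) (𝓝[>] 0) (𝓝 (B x)) := by
    have hg := hT.continuous_convolution_integrand B (hS.continuous_orbit x)
    have hc : Continuous fun t : ℝ =>
        ∫ s in (0 : ℝ)..1, T (max (t - t * s) 0) (B (S (max (t * s) 0) x)) :=
      intervalIntegral.continuous_parametric_intervalIntegral_of_continuous'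
        (f := fun t s : ℝ => T (max (t - t * s) 0) (B (S (max (t * s) 0) x)))
        (hg.comp (by fun_prop : Continuous fun p : ℝ × ℝ => (p.1, p.1 * p.2))) 0 1
    have h0 := (hc.tendsto 0).mono_left (nhdsWithin_le_nhds (s := Set.Ioi 0))
    simp only [zero_mul, sub_zero, max_self, hT.map_zero, hS.map_zero,
      ContinuousLinearMap.id_apply, intervalIntegral.integral_const, one_smul] at h0
    refine h0.congr' (eventually_mem_nhdsWithin.mono fun t ht => ?_)
    have := intervalIntegral.integral_comp_mul_left (a := 0) (b := 1)
      (fun s : ℝ => T (max (t - s) 0) (B (S (max s 0) x))) (Set.mem_Ioi.mp ht).ne'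
    rw [mul_zero, mul_one, RCLike.real_smul_eq_coe_smul (K := 𝕜)] at this
    exact this
  rw [hgraph, hAT]
  constructor
  · intro h
    have := h.add hconv
    rw [sub_add_cancel] at this
    refine this.congr' (eventually_mem_nhdsWithin.mono fun t ht => ?_)
    beta_reduce
    rw [hSeq t (Set.mem_Ioi.mp ht).le, ← smul_add]
    congr 1; abel
  · intro h
    refine (h.sub hconv).congr' (eventually_mem_nhdsWithin.mono fun t ht => ?_)
    beta_reduce
    rw [hSeq t (Set.mem_Ioi.mp ht).le, ← smul_sub]
    congr 1; abel

end Perturbation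

/-! ### Lyapunov inequalities and square integrable orbits. -/

section Lyapunov

variable {𝕜 : Type*} [RCLike 𝕜] {H : Type*} [NormedAddCommGroup H] [InnerProductSpace 𝕜 H]
  {T : ℝ → H →L[𝕜] H} {A : H →ₗ.[𝕜] H}

/-- Symmetry of `P` makes the two terms of the product rule have equal real parts. -/
theorem ContinuousLinearMap.IsPositive.hasDerivWithinAt_re_inner [NormedSpace ℝ H] [IsScalarTower ℝ 𝕜 H]
    {P : H →L[𝕜] H} (hP : P.IsPositive)
    {u : ℝ → H} {u' : H} {s : Set ℝ} {t : ℝ} (hu : HasDerivWithinAt u u' s t) :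
    HasDerivWithinAt (fun t => RCLike.re (inner 𝕜 (u t) (P (u t))))
      (2 * RCLike.re (inner 𝕜 u' (P (u t)))) s t := by
  have h1 : HasDerivWithinAt (fun t => P (u t)) (P u') s t :=
    (P.restrictScalars ℝ).hasFDerivAt.comp_hasDerivWithinAt t hu
  have h2 := hu.inner 𝕜 h1
  have h3 := (RCLike.reCLM (K := 𝕜)).hasFDerivAt.comp_hasDerivWithinAt t h2
  have h4 : RCLike.reCLM (inner 𝕜 (u t) (P u') + inner 𝕜 u' (P (u t))) =
      2 * RCLike.re (inner 𝕜 u' (P (u t))) := by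
    rw [← hP.inner_left_eq_inner_right (u t) u', RCLike.reCLM_apply, map_add,
      inner_re_symm (P (u t)) u']
    ring
  rw [h4] at h3
  exact h3

/-- Along an orbit in the domain, `Re ⟨u, P u⟩` decreases at rate at least `c ‖u‖²` and stays
nonnegative. Right derivatives suffice for the comparison, and density with continuity in `x` covers
all of `H`. -/
theorem IsInfinitesimalGenerator.integral_norm_sq_le [CompleteSpace H] [NormedSpace ℝ H]
    [IsScalarTower ℝ 𝕜 H] (hA : IsInfinitesimalGenerator A T) (hT : IsC0Semigroup T)
    {P : H →L[𝕜] H} (hP : P.IsPositive) {c : ℝ} (hc : 0 < c)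
    (hL : ∀ x : A.domain, 2 * RCLike.re (inner 𝕜 (A x) (P (x : H))) ≤ -c * ‖(x : H)‖ ^ 2)
    (x : H) {t : ℝ} (ht : 0 ≤ t) :
    ∫ s in (0 : ℝ)..t, ‖T (max s 0) x‖ ^ 2 ≤ c⁻¹ * RCLike.re (inner 𝕜 x (P x)) := by
  have hcont : Continuous fun x : H => ∫ s in (0 : ℝ)..t, ‖T (max s 0) x‖ ^ 2 :=
    by
    refine intervalIntegral.continuous_parametric_intervalIntegral_of_continuous'
      (f := fun (x : H) (s : ℝ) => ‖T (max s 0) x‖ ^ 2) ?_ 0 t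
    exact (hT.continuous_uncurry.comp continuous_swap).norm.pow 2
  have hclosed : IsClosed {x : H | ∫ s in (0 : ℝ)..t, ‖T (max s 0) x‖ ^ 2 ≤
      c⁻¹ * RCLike.re (inner 𝕜 x (P x))} := isClosed_le hcont (by fun_prop)
  refine hclosed.closure_subset_iff.mpr (fun x hx => ?_) (hA.dense_domain hT x)
  have hxy : (x, A ⟨x, hx⟩) ∈ A.graph := A.mem_graph ⟨x, hx⟩
  generalize A ⟨x, hx⟩ = y at hxy
  have horb := hT.continuous_orbit x
  have hle := image_le_of_deriv_right_le_deriv_boundary (a := 0) (b := t)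
    (f := fun s : ℝ => RCLike.re (inner 𝕜 (T s x) (P (T s x))))
    (f' := fun s : ℝ => 2 * RCLike.re (inner 𝕜 (T s y) (P (T s x))))
    (B := fun r : ℝ => RCLike.re (inner 𝕜 x (P x)) - c * ∫ s in (0 : ℝ)..r, ‖T (max s 0) x‖ ^ 2)
    (B' := fun s : ℝ => -(c * ‖T (max s 0) x‖ ^ 2))
    (by
      have := (hT.continuousOn_orbit x).mono (Set.Icc_subset_Ici_self : Set.Icc 0 t ⊆ Set.Ici 0)
      exact RCLike.continuous_re.comp_continuousOn
        (this.inner (P.continuous.comp_continuousOn this)))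
    (fun s hs => hP.hasDerivWithinAt_re_inner (hA.orbit hT hxy hs.1).2)
    (by simp [hT.map_zero])
    (by
      have : Continuous fun r : ℝ => ∫ s in (0 : ℝ)..r, ‖T (max s 0) x‖ ^ 2 :=
        intervalIntegral.continuous_primitive
          (fun a b => (horb.norm.pow 2).intervalIntegrable a b) 0
      exact (continuous_const.sub (continuous_const.mul this)).continuousOn)
    (fun s _ => (((horb.norm.pow 2).integral_hasStrictDerivAt 0 s).hasDerivAt.const_mul c
      |>.const_sub _).hasDerivWithinAt)
    (fun s hs => by
      obtain ⟨z, hz, hz'⟩ := (LinearPMap.mem_graph_iff A).mp (hA.orbit hT hxy hs.1).1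
      have := hL z
      simp only at hz hz'
      rw [hz, hz'] at this
      rw [max_eq_left hs.1]
      linarith)
    (Set.right_mem_Icc.mpr ht)
  have hpos := hP.re_inner_nonneg_right (T t x)
  have : c * ∫ s in (0 : ℝ)..t, ‖T (max s 0) x‖ ^ 2 ≤ RCLike.re (inner 𝕜 x (P x)) := by
    linarith
  rw [Set.mem_ofPred_eq, inv_mul_eq_div, le_div_iff₀ hc]
  linarith

/-- Lyapunov's inequality implies square integrability of the orbits. -/
theorem IsInfinitesimalGenerator.memLp_orbit [CompleteSpace H] [NormedSpace ℝ H]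
    [IsScalarTower ℝ 𝕜 H] (hA : IsInfinitesimalGenerator A T) (hT : IsC0Semigroup T)
    {P : H →L[𝕜] H} (hP : P.IsPositive) {c : ℝ} (hc : 0 < c)
    (hL : ∀ x : A.domain, 2 * RCLike.re (inner 𝕜 (A x) (P (x : H))) ≤ -c * ‖(x : H)‖ ^ 2)
    (x : H) : MemLp (fun t : ℝ => T t x) 2 (volume.restrict (Set.Ici (0 : ℝ))) := by
  have horb := hT.continuous_orbit x
  have h1 : IntegrableOn (fun s : ℝ => ‖T (max s 0) x‖ ^ 2) (Set.Ioi 0) := by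
    refine integrableOn_Ioi_of_intervalIntegral_norm_bounded
      (c⁻¹ * RCLike.re (inner 𝕜 x (P x))) 0 (fun n : ℕ => ?_) tendsto_natCast_atTop_atTop
      (Eventually.of_forall fun n => ?_)
    · exact ((horb.norm.pow 2).continuousOn.integrableOn_Icc).mono_set Set.Ioc_subset_Icc_self
    · simpa using hA.integral_norm_sq_le hT hP hc hL x (Nat.cast_nonneg n)
  have h2 : MemLp (fun t : ℝ => T (max t 0) x) 2 (volume.restrict (Set.Ici (0 : ℝ))) := by
    rw [memLp_two_iff_integrable_sq_norm horb.aestronglyMeasurable]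
    exact Iff.mpr integrableOn_Ici_iff_integrableOn_Ioi h1
  refine h2.ae_eq ?_
  filter_upwards [ae_restrict_mem measurableSet_Ici] with t ht
  rw [max_eq_left (Set.mem_Ici.mp ht)]

/-- A bounded operator whose range lies in that of another one factors through it. -/
theorem ContinuousLinearMap.exists_eq_comp_of_range_subset [CompleteSpace H] {Y : Type*}
    [NormedAddCommGroup Y] [NormedSpace 𝕜 Y] [CompleteSpace Y] (D : Y →L[𝕜] H) (P : H →L[𝕜] H)
    (h : Set.range D ⊆ Set.range P) : ∃ G : Y →L[𝕜] H, D = P.comp G := by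
  -- Preimages under `P` chosen in `(ker P)ᗮ` are unique, hence linear in `y`; the closed graph
  -- theorem makes them bounded.
  let K : Submodule 𝕜 H := LinearMap.ker (P : H →ₗ[𝕜] H)
  have hKc : IsClosed (K : Set H) := P.isClosed_ker
  have : CompleteSpace K := hKc.completeSpace_coe
  have hex : ∀ y, ∃ z, z ∈ Kᗮ ∧ P z = D y := fun y => by
    obtain ⟨w, hw⟩ := h ⟨y, rfl⟩
    obtain ⟨a, ha, b, hb, rfl⟩ := K.exists_add_mem_mem_orthogonal w
    refine ⟨b, hb, ?_⟩
    have : P a = 0 := ha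
    rw [← hw, map_add, this, zero_add]
  have huniq : ∀ z w, z ∈ Kᗮ → w ∈ Kᗮ → P z = P w → z = w := fun z w hz hw hzw => by
    have h1 : z - w ∈ K := by
      change P (z - w) = 0
      rw [map_sub, hzw, sub_self]
    have h2 : z - w ∈ Kᗮ := Kᗮ.sub_mem hz hw
    exact sub_eq_zero.mp (inner_self_eq_zero.mp (h2 _ h1))
  choose g hg hPg using hex
  let G : Y →ₗ[𝕜] H :=
    { toFun := g
      map_add' := fun x y => huniq _ _ (hg _) (Kᗮ.add_mem (hg _) (hg _)) (by simp [hPg])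
      map_smul' := fun c x => huniq _ _ (hg _) (Kᗮ.smul_mem _ (hg _)) (by simp [hPg]) }
  have hG : Continuous G := by
    refine G.continuous_of_seq_closed_graph fun u x y hu hGu => huniq _ _ ?_ (hg _) ?_
    · exact K.isClosed_orthogonal.mem_of_tendsto hGu (Eventually.of_forall fun n => hg (u n))
    · have h1 : Tendsto (fun n => P (g (u n))) atTop (𝓝 (P y)) := (P.continuous.tendsto y).comp hGu
      simp only [hPg] at h1
      rw [show P (G x) = D x from hPg x]
      exact tendsto_nhds_unique h1 ((D.continuous.tendsto x).comp hu)
  refine ⟨⟨G, hG⟩, ?_⟩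
  ext y
  exact (hPg y).symm

/-- The observability map `x ↦ T(·)x` of a semigroup with square integrable orbits. -/
theorem exists_observability_map [CompleteSpace H]
    (h2 : ∀ x : H, MemLp (fun t : ℝ => T t x) 2 (volume.restrict (Set.Ici (0 : ℝ)))) :
    ∃ L : H →L[𝕜] Lp H 2 (volume.restrict (Set.Ici (0 : ℝ))), ∀ x, L x = (h2 x).toLp := by
  let L : H →ₗ[𝕜] Lp H 2 (volume.restrict (Set.Ici (0 : ℝ))) :=
    { toFun := fun x => (h2 x).toLp
      map_add' := fun x y => by
        rw [← MemLp.toLp_add]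
        exact MemLp.toLp_congr _ _ (by filter_upwards with t; simp)
      map_smul' := fun c x => by
        rw [RingHom.id_apply, ← MemLp.toLp_const_smul]
        exact MemLp.toLp_congr _ _ (by filter_upwards with t; simp) }
  have hL : Continuous L := by
    -- Closed graph: an L² limit is an a.e. limit along a subsequence, while `T t (u n) → T t x` for
    -- every `t`.
    refine L.continuous_of_seq_closed_graph fun u x y hu hLu => ?_
    obtain ⟨φ, hφ, hae⟩ := (tendstoInMeasure_of_tendsto_Lp hLu).exists_seq_tendsto_ae
    refine Lp.ext ?_
    have hall : ∀ᵐ t ∂(volume.restrict (Set.Ici (0 : ℝ))), ∀ n, L (u n) t = T t (u n) :=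
      ae_all_iff.mpr fun n => (h2 (u n)).coeFn_toLp
    filter_upwards [hae, hall, (h2 x).coeFn_toLp] with t ht htn htx
    have h1 : Tendsto (fun n => T t (u (φ n))) atTop (𝓝 (T t x)) :=
      ((T t).continuous.tendsto x).comp (hu.comp hφ.tendsto_atTop)
    simp only [Function.comp_apply, htn] at ht
    exact (tendsto_nhds_unique ht h1).trans htx.symm
  exact ⟨⟨L, hL⟩, fun _ => rfl⟩

theorem MeasureTheory.MemLp.norm_toLp_two_sq (𝕜 : Type*) [RCLike 𝕜] {H : Type*}
    [NormedAddCommGroup H] [InnerProductSpace 𝕜 H] {α : Type*} [MeasurableSpace α] {μ : Measure α}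
    {f : α → H} (hf : MemLp f 2 μ) : ‖hf.toLp‖ ^ 2 = ∫ a, ‖f a‖ ^ 2 ∂μ := by
  have h1 : (inner 𝕜 hf.toLp hf.toLp : 𝕜) = ((∫ a, ‖f a‖ ^ 2 ∂μ : ℝ) : 𝕜) := by
    rw [L2.inner_def, ← integral_ofReal]
    refine integral_congr_ae ?_
    filter_upwards [hf.coeFn_toLp] with a ha
    rw [ha, inner_self_eq_norm_sq_to_K]
    simp
  rw [inner_self_eq_norm_sq_to_K] at h1
  exact_mod_cast h1

/-- A semigroup with square integrable orbits has a bounded solution of Lyapunov's equation. -/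
theorem IsInfinitesimalGenerator.exists_lyapunov [CompleteSpace H] [NormedSpace ℝ H]
    [IsScalarTower ℝ 𝕜 H] (hA : IsInfinitesimalGenerator A T) (hT : IsC0Semigroup T)
    (h2 : ∀ x : H, MemLp (fun t : ℝ => T t x) 2 (volume.restrict (Set.Ici (0 : ℝ)))) :
    ∃ P : H →L[𝕜] H, P.IsPositive ∧
      ∀ x : A.domain, 2 * RCLike.re (inner 𝕜 (A x) (P (x : H))) = -‖(x : H)‖ ^ 2 := by
  obtain ⟨L, hL⟩ := exists_observability_map h2
  have hP : ((ContinuousLinearMap.adjoint L).comp L).IsPositive :=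
    ContinuousLinearMap.isPositive_adjoint_comp_self L
  refine ⟨_, hP, fun x => ?_⟩
  have hnorm : ∀ x : H, RCLike.re (inner 𝕜 x ((ContinuousLinearMap.adjoint L).comp L x)) =
      ∫ t in Set.Ioi (0 : ℝ), ‖T t x‖ ^ 2 := fun x => by
    rw [ContinuousLinearMap.comp_apply, ContinuousLinearMap.adjoint_inner_right,
      inner_self_eq_norm_sq (𝕜 := 𝕜), hL, (h2 x).norm_toLp_two_sq 𝕜,
      integral_Ici_eq_integral_Ioi]
  have hintg : ∀ a : ℝ, 0 ≤ a → IntegrableOn (fun t => ‖T t (x : H)‖ ^ 2) (Set.Ioi a) := fun a ha =>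
    IntegrableOn.mono_set ((memLp_two_iff_integrable_sq_norm (h2 x).1).mp (h2 x))
      ((Set.Ioi_subset_Ioi ha).trans Set.Ioi_subset_Ici_self)
  -- Starting from `T h x` removes `[0, h]` from the integral. Differentiating both sides at `h = 0`
  -- gives Lyapunov's equation.
  have hshift : ∀ h : ℝ, 0 ≤ h → RCLike.re (inner 𝕜 (T h x)
      ((ContinuousLinearMap.adjoint L).comp L (T h x))) =
      (∫ t in Set.Ioi (0 : ℝ), ‖T t (x : H)‖ ^ 2) -
        ∫ t in (0 : ℝ)..h, ‖T (max t 0) (x : H)‖ ^ 2 := by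
    intro h hh
    have e1 : ∫ t in Set.Ioi (0 : ℝ), ‖T t (T h x)‖ ^ 2 =
        ∫ t in Set.Ioi h, ‖T t (x : H)‖ ^ 2 := by
      have := (measurePreserving_add_right (volume : Measure ℝ) h).setIntegral_preimage_emb
        (measurableEmbedding_addRight h) (fun t => ‖T t (x : H)‖ ^ 2) (Set.Ioi h)
      rw [← this]
      simp only [Set.preimage_add_const_Ioi, sub_self]
      refine setIntegral_congr_fun measurableSet_Ioi fun t ht => ?_
      have ht : (0 : ℝ) ≤ t := (Set.mem_Ioi.mp ht).le
      simp [hT.map_add t h ht hh]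
    have e2 : ∫ t in (0 : ℝ)..h, ‖T (max t 0) (x : H)‖ ^ 2 =
        ∫ t in (0 : ℝ)..h, ‖T t (x : H)‖ ^ 2 := by
      refine intervalIntegral.integral_congr fun t ht => ?_
      rw [Set.uIcc_of_le hh] at ht
      rw [max_eq_left ht.1]
    rw [hnorm, e1, e2, ← intervalIntegral.integral_interval_add_Ioi (hintg 0 le_rfl) (hintg h hh)]
    ring
  have hd1 := hP.hasDerivWithinAt_re_inner
    ((hA.mem_graph_iff_hasDerivWithinAt hT _ _).mp (A.mem_graph x))
  have hd2 : HasDerivWithinAt (fun h : ℝ => (∫ t in Set.Ioi (0 : ℝ), ‖T t (x : H)‖ ^ 2) -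
      ∫ t in (0 : ℝ)..h, ‖T (max t 0) (x : H)‖ ^ 2) (-‖(x : H)‖ ^ 2) (Set.Ici 0) 0 := by
    have := ((((hT.continuous_orbit (x : H)).norm.pow 2).integral_hasStrictDerivAt 0 0).hasDerivAt
      |>.const_sub (∫ t in Set.Ioi (0 : ℝ), ‖T t (x : H)‖ ^ 2)).hasDerivWithinAt (s := Set.Ici 0)
    simpa [hT.map_zero] using this
  have hd3 := hd2.congr_of_mem (fun h hh => hshift h hh) Set.self_mem_Ici
  have := (uniqueDiffWithinAt_Ici (0 : ℝ)).eq_deriv _ hd1 hd3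
  simpa [hT.map_zero] using this

end Lyapunov

/-! ### Detectability and the form inequality. -/

theorem theorem5p2 {𝕜 : Type*} [RCLike 𝕜]
    {H : Type*} [NormedAddCommGroup H] [InnerProductSpace 𝕜 H] [CompleteSpace H]
    {Y : Type*} [NormedAddCommGroup Y] [InnerProductSpace 𝕜 Y] [CompleteSpace Y]
    (A : H →ₗ.[𝕜] H) (hA : GeneratesC0Semigroup A) (C : H →L[𝕜] Y) :
    (IsExponentiallyDetectable A C →
      ∃ P : H →L[𝕜] H, P.IsPositive ∧ LyapunovFormInequality A C P) ∧
    (∀ P : H →L[𝕜] H, P.IsPositive → LyapunovFormInequality A C P →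
      Set.range (ContinuousLinearMap.adjoint C) ⊆ Set.range P →
      IsExponentiallyDetectable A C) := by
  let : NormedSpace ℝ H := NormedSpace.restrictScalars ℝ 𝕜 H
  have : IsScalarTower ℝ 𝕜 H := .restrictScalars ℝ 𝕜 H
  constructor
  · rintro ⟨F, T, hT, hAT, h2⟩
    obtain ⟨P, hP, hPL⟩ := hAT.exists_lyapunov hT h2
    set K : ℝ := ‖F‖ * ‖P‖ with hK
    -- Young's inequality costs `η² K² ‖x‖²` out of `η ‖x‖²`; `η K² ≤ 1/2` leaves `m = η/2`.
    have hη : 0 < 1 / (2 * (K ^ 2 + 1)) := by positivity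
    refine ⟨P, hP, 1 / (2 * (K ^ 2 + 1)), 1 / (4 * (K ^ 2 + 1)), hη, by positivity, fun x => ?_⟩
    have h1 : 2 * (RCLike.re (inner 𝕜 (F (C x)) (P (x : H))) +
        RCLike.re (inner 𝕜 (A x) (P (x : H)))) = -‖(x : H)‖ ^ 2 := by
      have := hPL x
      rw [LinearPMap.vadd_apply, inner_add_left, map_add] at this
      exact this
    have h3 : -(K * ‖C x‖ * ‖(x : H)‖) ≤ RCLike.re (inner 𝕜 (F (C x)) (P (x : H))) := by
      refine (abs_le.mp ((RCLike.abs_re_le_norm _).trans ((norm_inner_le_norm _ _).trans ?_))).1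
      calc ‖F (C x)‖ * ‖P (x : H)‖ ≤ (‖F‖ * ‖C x‖) * (‖P‖ * ‖(x : H)‖) := by
            gcongr <;> exact ContinuousLinearMap.le_opNorm _ _
        _ = _ := by rw [hK]; ring
    set η : ℝ := 1 / (2 * (K ^ 2 + 1)) with hηd
    have hηK : η * K ^ 2 ≤ 1 / 2 := by
      rw [hηd, one_div_mul_eq_div, div_le_div_iff₀ (by positivity) (by norm_num)]
      nlinarith
    have hm : 1 / (4 * (K ^ 2 + 1)) = η / 2 := by rw [hηd]; field_simp; norm_num
    rw [hm]
    have h4 : 0 ≤ (‖C x‖ - η * K * ‖(x : H)‖) ^ 2 := sq_nonneg _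
    have h5 : η * ‖(x : H)‖ ^ 2 * (η * K ^ 2) ≤ η * ‖(x : H)‖ ^ 2 * (1 / 2) := by gcongr
    have h6 := mul_le_mul_of_nonneg_left h3 hη.le
    have h7 : 2 * η * RCLike.re (inner 𝕜 (A x) (P (x : H))) = -(η * ‖(x : H)‖ ^ 2) -
        2 * (η * RCLike.re (inner 𝕜 (F (C x)) (P (x : H)))) := by linear_combination η * h1
    rw [h7]
    linarith
  · rintro P hP ⟨η, m, hη, hm, hineq⟩ hran
    obtain ⟨G, hG⟩ := (ContinuousLinearMap.adjoint C).exists_eq_comp_of_range_subset P hran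
    -- The factor makes `2 η Re ⟨F C x, P x⟩` equal to `-‖C x‖²`, giving decay constant `m / η`.
    let F : Y →L[𝕜] H := ((-(1 / (2 * η)) : ℝ) : 𝕜) • G
    obtain ⟨T, hT, hAT⟩ := hA.vadd (F.comp C)
    refine ⟨F, T, hT, hAT, hAT.memLp_orbit hT hP (div_pos hm hη) fun x => ?_⟩
    have h1 : RCLike.re (inner 𝕜 (F (C x)) (P (x : H))) = -(1 / (2 * η)) * ‖C x‖ ^ 2 := by
      have h2 : inner 𝕜 (G (C x)) (P (x : H)) = inner 𝕜 (C x) (C x) := by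
        rw [← hP.inner_left_eq_inner_right, ← ContinuousLinearMap.comp_apply, ← hG,
          ContinuousLinearMap.adjoint_inner_left]
      rw [_root_.smul_apply, inner_smul_left, RCLike.conj_ofReal, RCLike.re_ofReal_mul, h2,
        inner_self_eq_norm_sq]
    have h3 := hineq x
    rw [LinearPMap.vadd_apply, inner_add_left, map_add]
    change 2 * (RCLike.re (inner 𝕜 (F (C x)) (P (x : H))) +
      RCLike.re (inner 𝕜 (A x) (P (x : H)))) ≤ _
    rw [h1]
    have h4 : 2 * (-(1 / (2 * η)) * ‖C x‖ ^ 2 + RCLike.re (inner 𝕜 (A x) (P (x : H)))) =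
        -(‖C x‖ ^ 2 - 2 * η * RCLike.re (inner 𝕜 (A x) (P (x : H)))) / η := by
      field_simp; ring
    rw [h4, neg_div, neg_mul, neg_le_neg_iff, div_mul_eq_mul_div]
    gcongr
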